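/- Let $E$ be a real Banach space with dual $E^*$ and bidual $E^{**}$, and write $\langle\cdot,\cdot\rangle$ for the pairings $E\times E^*\to\mathbb R$ and $E^*\times E^{**}\to\mathbb R$. For a multifunction $S\colon E\rightrightarrows E^*$ with graph $G(S)$, let $$\varphi_S(x,x^*)=\sup_{(s,s^*)\in G(S)}\big[\langle s,x^*\rangle+\langle x,s^*\rangle-\langle s,s^*\rangle\big]\qquad((x,x^*)\in E\times E^*)$$ be its Fitzpatrick function, and let $$\varphi_S^*(y^*,y^{**})=\sup_{(x,x^*)\in E\times E^*}\big[\langle x,y^*\rangle+\langle x^*,y^{**}\rangle-\varphi_S(x,x^*)\big]\qquad((y^*,y^{**})\in E^*\times E^{**})$$ be the Fenchel conjugate of $\varphi_S$. The Fitzpatrick extension of $S$ is the multifunction $S^{\mathbb F}\colon E^*\rightrightarrows E^{**}$ given by $$(y^*,y^{**})\in G(S^{\mathbb F})\iff\varphi_S^*(y^*,y^{**})=\langle y^*,y^{**}\rangle.$$ For a proper convex lower semicontinuous $f\colon E\to{]-\infty,\infty]}$ with Fenchel conjugate $f^*(x^*)=\sup_{x\in E}[\langle x,x^*\rangle-f(x)]$,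 the subdifferential $\partial f\colon E\rightrightarrows E^*$ is given by $x^*\in\partial f(x)\iff f(x)+f^*(x^*)=\langle x,x^*\rangle$. **Theorem.** Let $\widetilde K$ be a nonempty convex subset of $E^*$ that is compact in the weak* topology $w(E^*,E)$, and define $\tau_{\widetilde K}\colon E\to\mathbb R$ by $\tau_{\widetilde K}(x)=\max_{k\in\widetilde K}\langle x,k\rangle$. Then, for all $(y^*,y^{**})\in E^*\times E^{**}$, $$(y^*,y^{**})\in G\big((\partial\tau_{\widetilde K})^{\mathbb F}\big)\iff y^*\in\widetilde K\ \text{ and }\ \langle y^*,y^{**}\rangle=\sup_{k\in\widetilde K}\langle k,y^{**}\rangle.$$ -/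

import Mathlib

noncomputable section

namespace FitzExt

/-- The Fenchel conjugate `f*(x*) = sup_x [⟨x, x*⟩ - f x]` of an extended-real-valued function
on a real normed space. -/
def fenchelConj {X : Type*} [NormedAddCommGroup X] [NormedSpace ℝ X]
    (f : X → EReal) (x' : StrongDual ℝ X) : EReal :=
  ⨆ x : X, (((x' x : ℝ) : EReal) - f x)

/-- The subdifferential of `f`, as a multifunction from `X` to its dual:
`x* ∈ ∂f(x)` if and only if `f(x) + f*(x*) = ⟨x, x*⟩`. -/
def subdiff {X : Type*} [NormedAddCommGroup X] [NormedSpace ℝ X]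
    (f : X → EReal) (x : X) : Set (StrongDual ℝ X) :=
  {x' | f x + fenchelConj f x' = ((x' x : ℝ) : EReal)}

/-- The graph of a multifunction. -/
def graph {X Y : Type*} (S : X → Set Y) : Set (X × Y) :=
  {p | p.2 ∈ S p.1}

/-- The Fitzpatrick function
`φ_S(x, x*) = sup {⟨s, x*⟩ + ⟨x, s*⟩ - ⟨s, s*⟩ : (s, s*) ∈ G(S)}` of a multifunction. -/
def fitzFun {E : Type*} [NormedAddCommGroup E] [NormedSpace ℝ E]
    (S : E → Set (StrongDual ℝ E)) (p : E × StrongDual ℝ E) : EReal :=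
  ⨆ q ∈ graph S, ((p.2 q.1 + q.2 p.1 - q.2 q.1 : ℝ) : EReal)

/-- The Fitzpatrick extension `S^F` of `S`, a multifunction from `E*` to `E**`:
`y** ∈ S^F(y*)` if and only if `φ_S*(y*, y**) = ⟨y*, y**⟩`. The pair `(y*, y**)` stands for the
functional `(x, x*) ↦ ⟨x, y*⟩ + ⟨x*, y**⟩` on `E × E*`, which is `y*.coprod y**`. -/
def fitzExt {E : Type*} [NormedAddCommGroup E] [NormedSpace ℝ E]
    (S : E → Set (StrongDual ℝ E)) (y' : StrongDual ℝ E) :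
    Set (StrongDual ℝ (StrongDual ℝ E)) :=
  {y'' | fenchelConj (fitzFun S) (y'.coprod y'') = ((y'' y' : ℝ) : EReal)}

/-- The support functional `τ_K(x) = sup {⟨x, k⟩ : k ∈ K}` of a set `K ⊆ E*`; the supremum is
attained when `K` is nonempty and weak*-compact, see `tau_isGreatest`. -/
def tau {E : Type*} [NormedAddCommGroup E] [NormedSpace ℝ E]
    (K : Set (StrongDual ℝ E)) (x : E) : EReal :=
  ⨆ k ∈ K, ((k x : ℝ) : EReal)

theorem tau_isGreatest {E : Type*} [NormedAddCommGroup E] [NormedSpace ℝ E]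
    (K : Set (StrongDual ℝ E)) (hne : K.Nonempty)
    (hK : IsCompact (StrongDual.toWeakDual '' K)) (x : E) :
    IsGreatest ((fun k : StrongDual ℝ E => ((k x : ℝ) : EReal)) '' K) (tau K x) := by
  obtain ⟨w, ⟨k, hk, rfl⟩, hmax⟩ := hK.exists_isMaxOn (hne.image _)
    (WeakDual.eval_continuous x).continuousOn
  have hle : ∀ k' ∈ K, k' x ≤ k x := fun k' hk' => hmax ⟨k', hk', rfl⟩
  have h : tau K x = ((k x : ℝ) : EReal) := by
    apply le_antisymm
    · exact iSup₂_le fun k' hk' => EReal.coe_le_coe_iff.2 (hle k' hk')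
    · exact le_iSup₂ (f := fun (k : StrongDual ℝ E) (_ : k ∈ K) => ((k x : ℝ) : EReal)) k hk
  rw [h]
  refine ⟨⟨k, hk, rfl⟩, ?_⟩
  rintro _ ⟨k', hk', rfl⟩
  exact EReal.coe_le_coe_iff.2 (hle k' hk')

end FitzExt

end

namespace FitzExt

variable {E : Type*} [NormedAddCommGroup E] [NormedSpace ℝ E] {K : Set (StrongDual ℝ E)}

/-! Write τ for `tau K` and I for the indicator of `K` (0 on `K`, ⊤ elsewhere). By weak* separation
and positive homogeneity, τ* = I, so the subgradients of τ at x are the elements of `K` attaining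
the maximum at x. It follows that the Fitzpatrick function splits as φ(x, k) = τ(x) + I(k), and
hence φ*(y', y'') = I(y') + sup over `K` of y''. This equals the real number ⟨y', y''⟩ exactly under
the stated condition. -/

/-- A point outside a weak*-compact convex set of functionals is strictly separated from it by
evaluation at a vector. -/
theorem exists_forall_apply_lt (hconv : Convex ℝ K)
    (hK : IsCompact (StrongDual.toWeakDual '' K)) {y : StrongDual ℝ E} (hy : y ∉ K) :
    ∃ x : E, ∀ k ∈ K, k x < y x := by
  have hloc : LocallyConvexSpace ℝ (WeakDual ℝ E) :=
    inferInstanceAs (LocallyConvexSpace ℝ (WeakBilin (topDualPairing ℝ E)))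
  have hy' : StrongDual.toWeakDual y ∉ StrongDual.toWeakDual '' K := by
    rintro ⟨k, hk, h⟩
    exact hy (StrongDual.toWeakDual_inj _ _ |>.1 h ▸ hk)
  obtain ⟨f, u, hf, hu⟩ := geometric_hahn_banach_closed_point
    (hconv.linear_image (StrongDual.toWeakDual (𝕜 := ℝ) (E := E)).toLinearMap) hK.isClosed hy'
  -- Weak*-continuous functionals are evaluations, so the separation takes place in `E`, not in its
  -- bidual.
  obtain ⟨x, hx⟩ := LinearMap.dualEmbedding_surjective (topDualPairing ℝ E) f
  have hfx : ∀ w : StrongDual ℝ E, f (StrongDual.toWeakDual w) = w x := fun w => by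
    rw [← hx]; rfl
  refine ⟨x, fun k hk => ?_⟩
  have h1 := hf _ ⟨k, hk, rfl⟩
  have h2 := h1.trans hu
  rwa [LinearEquiv.coe_coe, hfx, hfx] at h2

theorem apply_le_tau {k : StrongDual ℝ E} (hk : k ∈ K) (x : E) :
    ((k x : ℝ) : EReal) ≤ tau K x :=
  le_iSup₂ (f := fun (k : StrongDual ℝ E) (_ : k ∈ K) => ((k x : ℝ) : EReal)) k hk

theorem tau_eq_of_forall_le {k : StrongDual ℝ E} (hk : k ∈ K) {x : E}
    (h : ∀ k' ∈ K, k' x ≤ k x) : tau K x = ((k x : ℝ) : EReal) :=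
  le_antisymm (iSup₂_le fun k' hk' => EReal.coe_le_coe_iff.2 (h k' hk')) (apply_le_tau hk x)

theorem exists_tau_eq (hne : K.Nonempty) (hK : IsCompact (StrongDual.toWeakDual '' K)) (x : E) :
    ∃ k ∈ K, tau K x = ((k x : ℝ) : EReal) ∧ ∀ k' ∈ K, k' x ≤ k x := by
  obtain ⟨⟨k, hk, h⟩, -⟩ := tau_isGreatest K hne hK x
  have h' : ((k x : ℝ) : EReal) = tau K x := h
  exact ⟨k, hk, h'.symm, fun k' hk' => EReal.coe_le_coe_iff.1 (h' ▸ apply_le_tau hk' x)⟩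

theorem tau_zero (hne : K.Nonempty) : tau K 0 = 0 := by
  obtain ⟨k, hk⟩ := hne
  simp [tau_eq_of_forall_le hk (x := 0) (by simp)]

/-- If `y` lies outside `K`, then `y - tau K` is unbounded above. -/
theorem exists_lt_apply_sub_tau (hne : K.Nonempty) (hconv : Convex ℝ K)
    (hK : IsCompact (StrongDual.toWeakDual '' K)) {y : StrongDual ℝ E} (hy : y ∉ K) (c : ℝ) :
    ∃ x : E, ∃ k ∈ K, tau K x = ((k x : ℝ) : EReal) ∧ (∀ k' ∈ K, k' x ≤ k x) ∧
      c < y x - k x := by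
  obtain ⟨x, hx⟩ := exists_forall_apply_lt hconv hK hy
  obtain ⟨k, hk, -, hmax⟩ := exists_tau_eq hne hK x
  have hpos : 0 < y x - k x := sub_pos.2 (hx k hk)
  -- Scaling by `t` stretches the gap to `|c| + 1 > c` and keeps `k` a maximizer.
  set t : ℝ := (|c| + 1) / (y x - k x)
  have ht : 0 ≤ t := by positivity
  have hmax' : ∀ k' ∈ K, k' (t • x) ≤ k (t • x) := fun k' hk' => by
    simpa using mul_le_mul_of_nonneg_left (hmax k' hk') ht
  refine ⟨t • x, k, hk, tau_eq_of_forall_le hk hmax', hmax', ?_⟩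
  have : t * (y x - k x) = |c| + 1 := div_mul_cancel₀ _ hpos.ne'
  simp only [map_smul, smul_eq_mul, ← mul_sub, this]
  linarith [le_abs_self c]

theorem fenchelConj_tau_of_mem (hne : K.Nonempty) (hK : IsCompact (StrongDual.toWeakDual '' K))
    {k : StrongDual ℝ E} (hk : k ∈ K) : fenchelConj (tau K) k = 0 := by
  apply le_antisymm
  · refine iSup_le fun x => ?_
    obtain ⟨k', -, h, hmax⟩ := exists_tau_eq hne hK x
    rw [h]
    exact_mod_cast sub_nonpos.2 (hmax k hk)
  · refine le_iSup_of_le 0 ?_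
    simp [tau_zero hne]

theorem fenchelConj_tau_of_notMem (hne : K.Nonempty) (hconv : Convex ℝ K)
    (hK : IsCompact (StrongDual.toWeakDual '' K)) {y : StrongDual ℝ E} (hy : y ∉ K) :
    fenchelConj (tau K) y = ⊤ := by
  refine EReal.eq_top_iff_forall_lt _ |>.2 fun c => ?_
  obtain ⟨x, k, -, h, -, hc⟩ := exists_lt_apply_sub_tau hne hconv hK hy c
  refine lt_of_lt_of_le ?_ (le_iSup _ x)
  rw [h]
  exact_mod_cast hc

theorem mem_subdiff_tau (hne : K.Nonempty) (hconv : Convex ℝ K)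
    (hK : IsCompact (StrongDual.toWeakDual '' K)) {x : E} {k : StrongDual ℝ E} :
    k ∈ subdiff (tau K) x ↔ k ∈ K ∧ tau K x = ((k x : ℝ) : EReal) := by
  change tau K x + fenchelConj (tau K) k = _ ↔ _
  by_cases hk : k ∈ K
  · simp [fenchelConj_tau_of_mem hne hK hk, hk]
  · obtain ⟨k', -, h, -⟩ := exists_tau_eq hne hK x
    simp [fenchelConj_tau_of_notMem hne hconv hK hk, hk, h]

theorem fitzFun_subdiff_tau_of_mem (hne : K.Nonempty) (hconv : Convex ℝ K)
    (hK : IsCompact (StrongDual.toWeakDual '' K)) (x : E) {k : StrongDual ℝ E} (hk : k ∈ K) :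
    fitzFun (subdiff (tau K)) (x, k) = tau K x := by
  obtain ⟨m, hm, h, hmax⟩ := exists_tau_eq hne hK x
  rw [h]
  apply le_antisymm
  · refine iSup₂_le ?_
    rintro ⟨s, s'⟩ hs
    obtain ⟨hs', hts⟩ := (mem_subdiff_tau hne hconv hK).1 hs
    -- Thus `k s - s' s ≤ 0`, leaving only `s' x ≤ m x`.
    have h1 : k s ≤ s' s := EReal.coe_le_coe_iff.1 (hts ▸ apply_le_tau hk s)
    exact EReal.coe_le_coe_iff.2 (by linarith [hmax s' hs'])
  -- Every element of `K` is a subgradient at 0; the pair `(0, m)` contributes exactly `m x`.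
  · refine le_iSup₂_of_le (0, m) ((mem_subdiff_tau hne hconv hK).2 ⟨hm, ?_⟩) ?_
    · simp [tau_zero hne]
    · simp

theorem fitzFun_subdiff_tau_of_notMem (hne : K.Nonempty) (hconv : Convex ℝ K)
    (hK : IsCompact (StrongDual.toWeakDual '' K)) (x : E) {y : StrongDual ℝ E} (hy : y ∉ K) :
    fitzFun (subdiff (tau K)) (x, y) = ⊤ := by
  refine EReal.eq_top_iff_forall_lt _ |>.2 fun c => ?_
  -- Maximizing at `-x` bounds `k x` below by `-m (-x)` uniformly over `K`, before `k` is chosen.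
  obtain ⟨m, -, -, hmax⟩ := exists_tau_eq hne hK (-x)
  obtain ⟨s, k, hk, h, -, hc⟩ := exists_lt_apply_sub_tau hne hconv hK hy (c + m (-x))
  refine lt_of_lt_of_le ?_
    (le_iSup₂_of_le (s, k) ((mem_subdiff_tau hne hconv hK).2 ⟨hk, h⟩) le_rfl)
  have h1 := hmax k hk
  rw [map_neg k] at h1
  exact EReal.coe_lt_coe_iff.2 (by linarith)

theorem fenchelConj_fitzFun_subdiff_tau_of_mem (hne : K.Nonempty) (hconv : Convex ℝ K)
    (hK : IsCompact (StrongDual.toWeakDual '' K)) {y' : StrongDual ℝ E} (hy : y' ∈ K)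
    (y'' : StrongDual ℝ (StrongDual ℝ E)) :
    fenchelConj (fitzFun (subdiff (tau K))) (y'.coprod y'') =
      ⨆ k ∈ K, ((y'' k : ℝ) : EReal) := by
  apply le_antisymm
  · refine iSup_le ?_
    rintro ⟨x, k⟩
    by_cases hk : k ∈ K
    · obtain ⟨m, -, h, hmax⟩ := exists_tau_eq hne hK x
      refine le_iSup₂_of_le k hk ?_
      rw [fitzFun_subdiff_tau_of_mem hne hconv hK x hk, h, ← EReal.coe_sub,
        EReal.coe_le_coe_iff, ContinuousLinearMap.coprod_apply]
      linarith [hmax y' hy]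
    · rw [fitzFun_subdiff_tau_of_notMem hne hconv hK x hk]
      simp
  · refine iSup₂_le fun k hk => le_iSup_of_le (0, k) ?_
    simp [fitzFun_subdiff_tau_of_mem hne hconv hK 0 hk, tau_zero hne]

theorem fenchelConj_fitzFun_subdiff_tau_of_notMem (hne : K.Nonempty) (hconv : Convex ℝ K)
    (hK : IsCompact (StrongDual.toWeakDual '' K)) {y' : StrongDual ℝ E} (hy : y' ∉ K)
    (y'' : StrongDual ℝ (StrongDual ℝ E)) :
    fenchelConj (fitzFun (subdiff (tau K))) (y'.coprod y'') = ⊤ := by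
  obtain ⟨k, hk⟩ := hne
  refine EReal.eq_top_iff_forall_lt _ |>.2 fun c => ?_
  -- With the second argument fixed at `k`, φ is the finite τ and `y''` adds only the constant `y''
  -- k`.
  obtain ⟨x, m, -, h, -, hc⟩ :=
    exists_lt_apply_sub_tau ⟨k, hk⟩ hconv hK hy (c - y'' k)
  refine lt_of_lt_of_le ?_ (le_iSup _ (x, k))
  rw [fitzFun_subdiff_tau_of_mem ⟨k, hk⟩ hconv hK x hk, h, ← EReal.coe_sub,
    EReal.coe_lt_coe_iff, ContinuousLinearMap.coprod_apply]
  linarith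

end FitzExt

theorem mainTheorem10 {E : Type*} [NormedAddCommGroup E] [NormedSpace ℝ E] [CompleteSpace E]
    (K : Set (StrongDual ℝ E)) (hne : K.Nonempty) (hconv : Convex ℝ K)
    (hK : IsCompact (StrongDual.toWeakDual '' K))
    (y' : StrongDual ℝ E) (y'' : StrongDual ℝ (StrongDual ℝ E)) :
    (y', y'') ∈ FitzExt.graph (FitzExt.fitzExt (FitzExt.subdiff (FitzExt.tau K))) ↔
      y' ∈ K ∧ ((y'' y' : ℝ) : EReal) = ⨆ k ∈ K, ((y'' k : ℝ) : EReal) := by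
  change FitzExt.fenchelConj (FitzExt.fitzFun (FitzExt.subdiff (FitzExt.tau K)))
    (y'.coprod y'') = _ ↔ _
  by_cases hy : y' ∈ K
  · rw [FitzExt.fenchelConj_fitzFun_subdiff_tau_of_mem hne hconv hK hy]
    exact ⟨fun h => ⟨hy, h.symm⟩, fun h => h.2.symm⟩
  · simp [FitzExt.fenchelConj_fitzFun_subdiff_tau_of_notMem hne hconv hK hy, hy]
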